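/- Let $f:\mathbb{R}^n\to\mathbb{R}$ be strictly concave and $g=(g_1,\dots,g_m):\mathbb{R}^n\to\mathbb{R}^m$ have convex components; assume that $f$ and all $g_i$ are continuously differentiable with locally Lipschitz gradients, and that Slater's condition holds: there is $x\in\mathbb{R}^n$ with $g_i(x)<0$ for all $i$. For $a\in\mathbb{R}$ and $b\ge 0$ put $[a]_b^+=a$ if $b>0$ and $[a]_b^+=\max\{0,a\}$ if $b=0$. The primal-dual dynamics on $D=\mathbb{R}^n\times\mathbb{R}^m_{\ge 0}$ is $$\dot x=\nabla f(x)-\sum_{i=1}^m\lambda_i\nabla g_i(x),\qquad \dot\lambda_i=[g_i(x)]_{\lambda_i}^+\quad(i=1,\dots,m).$$ A (Caratheodory) solution on $[0,T)$, $0<T\le\infty$, is a curve $[0,T)\to D$ that is absolutely continuous on every compact subinterval of $[0,T)$ and satisfies these equations for almost every $t\in[0,T)$. For a solution $\gamma$ on $[0,\infty)$, its omega-limit set $\Omega(\gamma)$ is the set of all $y\in\mathbb{R}^n\times\mathbb{R}^m$ for which there are $t_k\in[0,\infty)$ with $t_k\to\infty$ and $\gamma(t_k)\to y$. Then, for every solution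 $\gamma:[0,\infty)\to D$ of the primal-dual dynamics starting from any point of $D$, the set $\Omega(\gamma)$ is invariant under the primal-dual dynamics: every solution $\varphi$, on any interval $[0,T)$ with $0<T\le\infty$, with $\varphi(0)\in\Omega(\gamma)$ satisfies $\varphi(t)\in\Omega(\gamma)$ for all $t\in[0,T)$. -/

import Mathlib

open Filter Topology MeasureTheory

noncomputable section

namespace PrimalDual

section Caratheodory

variable {E : Type*} [NormedAddCommGroup E] [NormedSpace ℝ E]

/-- `γ` restricted to `[0, T)`, with `0 < T ≤ ∞`, is a Caratheodory solution of `γ' = F γ`, where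
the vector field `F` is considered on the domain `D` only: the curve takes its values in `D`, it is
absolutely continuous on every compact subinterval of `[0, T)`, and it satisfies the differential
equation for almost every `t` in `[0, T)`. The values of `γ` outside `[0, T)` are irrelevant. -/
structure IsCaratheodorySolution (F : E → E) (D : Set E) (T : EReal) (γ : ℝ → E) : Prop where
  pos : 0 < T
  mem : ∀ t : ℝ, 0 ≤ t → (t : EReal) < T → γ t ∈ D
  absolutelyContinuous :
    ∀ b : ℝ, 0 ≤ b → (b : EReal) < T → AbsolutelyContinuousOnInterval γ 0 b
  hasDerivAt :
    ∀ᵐ t : ℝ ∂volume, 0 ≤ t → (t : EReal) < T → HasDerivAt γ (F (γ t)) t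

/-- `S` is invariant: every solution, on whatever interval `[0, T)` it is defined, that starts at a
point of `S` remains in `S`. -/
def IsInvariant (F : E → E) (D : Set E) (S : Set E) : Prop :=
  ∀ (T : EReal) (γ : ℝ → E), IsCaratheodorySolution F D T γ → γ 0 ∈ S →
    ∀ t : ℝ, 0 ≤ t → (t : EReal) < T → γ t ∈ S

/-- The omega-limit set of a curve defined on `[0, ∞)`. -/
def omegaLimitSet (γ : ℝ → E) : Set E :=
  {y | ∃ t : ℕ → ℝ, (∀ k, 0 ≤ t k) ∧ Tendsto t atTop atTop ∧
    Tendsto (fun k => γ (t k)) atTop (𝓝 y)}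

end Caratheodory

/-- The operator `[a]_b^+`, equal to `a` for `b > 0` and to `max {0, a}` for `b = 0`.
It is only used for `b ≥ 0`. -/
def plusOperator (a b : ℝ) : ℝ := if 0 < b then a else max 0 a

/-- The domain `ℝⁿ × ℝ^m_{≥ 0}`. -/
def domain (n m : ℕ) : Set (EuclideanSpace ℝ (Fin n) × EuclideanSpace ℝ (Fin m)) :=
  {z | ∀ i, 0 ≤ z.2 i}

/-- The primal-dual vector field
`(x, μ) ↦ (∇ f x - ∑ i, μ i • ∇ (g i) x, [g x]_μ^+)`. -/
def vectorField {n m : ℕ} (f : EuclideanSpace ℝ (Fin n) → ℝ)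
    (g : Fin m → EuclideanSpace ℝ (Fin n) → ℝ)
    (z : EuclideanSpace ℝ (Fin n) × EuclideanSpace ℝ (Fin m)) :
    EuclideanSpace ℝ (Fin n) × EuclideanSpace ℝ (Fin m) :=
  (gradient f z.1 - ∑ i, z.2 i • gradient (g i) z.1,
    WithLp.toLp 2 fun i => plusOperator (g i z.1) (z.2 i))

end PrimalDual

end

/-! The dynamics is a contraction, in the weak sense, for the Euclidean distance. Concavity of `f`
makes its gradient part dissipative. In the coupling with `g`, convexity and nonnegative multipliers
make the cross terms cancel or help, and the truncation `plusOperator` only helps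
(`inner_sub_vectorField_sub_nonpos`). Hence two solutions never move apart (`norm_sq_sub_le`). If `γ
(t k) → φ 0`, comparing `φ` with the shifts of `γ` by `t k` gives `γ (t k + s) → φ s`. -/

/-- Postcomposition with a Lipschitz map preserves absolute continuity. -/
theorem LipschitzWith.comp_absolutelyContinuousOnInterval {X Y : Type*}
    [PseudoMetricSpace X] [PseudoMetricSpace Y] {K : NNReal} {h : X → Y} (hh : LipschitzWith K h)
    {f : ℝ → X} {a b : ℝ} (hf : AbsolutelyContinuousOnInterval f a b) :
    AbsolutelyContinuousOnInterval (fun t => h (f t)) a b := by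
  refine squeeze_zero (fun E => Finset.sum_nonneg fun i _ => dist_nonneg) (fun E => ?_)
    (by simpa using Tendsto.const_mul (K : ℝ) hf)
  rw [Finset.mul_sum]
  exact Finset.sum_le_sum fun i _ => hh.dist_le_mul _ _

open Set in
/-- Absolute continuity is invariant under translations. -/
theorem AbsolutelyContinuousOnInterval.comp_const_add {X : Type*} [PseudoMetricSpace X]
    {f : ℝ → X} {a b s : ℝ} (hf : AbsolutelyContinuousOnInterval f (s + a) (s + b)) :
    AbsolutelyContinuousOnInterval (fun t => f (s + t)) a b := by
  rw [absolutelyContinuousOnInterval_iff] at hf ⊢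
  intro ε hε
  obtain ⟨δ, hδ, h⟩ := hf ε hε
  refine ⟨δ, hδ, fun E hE hEδ => ?_⟩
  refine h (E.1, fun i => (s + (E.2 i).1, s + (E.2 i).2)) ⟨fun i hi => ?_, ?_⟩ ?_
  · obtain ⟨h₁, h₂⟩ := hE.1 i hi
    rw [mem_uIcc] at h₁ h₂
    exact ⟨by rw [mem_uIcc]; simpa using h₁, by rw [mem_uIcc]; simpa using h₂⟩
  · intro i hi j hj hij
    have hdisj : Disjoint (uIoc (E.2 i).1 (E.2 i).2) (uIoc (E.2 j).1 (E.2 j).2) :=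
      hE.2 hi hj hij
    have hmem : ∀ k x, x ∈ uIoc (s + (E.2 k).1) (s + (E.2 k).2) →
        x - s ∈ uIoc (E.2 k).1 (E.2 k).2 := fun k x hx => by
      rw [mem_uIoc] at hx ⊢
      simpa only [lt_sub_iff_add_lt', sub_le_iff_le_add'] using hx
    exact disjoint_left.2 fun x hxi hxj => disjoint_left.1 hdisj (hmem i x hxi) (hmem j x hxj)
  · simpa using hEδ

/-- A real absolutely continuous function with nonpositive derivative almost everywhere does not
increase. -/
theorem AbsolutelyContinuousOnInterval.le_of_deriv_nonpos {V : ℝ → ℝ} {a b : ℝ} (hab : a ≤ b)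
    (hV : AbsolutelyContinuousOnInterval V a b)
    (h : ∀ᵐ t : ℝ, t ∈ Set.Ioo a b → deriv V t ≤ 0) : V b ≤ V a := by
  have h₁ : ∫ t in a..b, deriv V t ≤ ∫ t in a..b, (0 : ℝ) := by
    refine intervalIntegral.integral_mono_ae_restrict hab hV.intervalIntegrable_deriv (by simp) ?_
    rw [← restrict_Ioo_eq_restrict_Icc]
    exact (ae_restrict_iff' measurableSet_Ioo).2 h
  rw [hV.integral_deriv_eq_sub] at h₁
  simpa using h₁

/-- The first-order condition for convexity. -/
theorem ConvexOn.inner_gradient_le_sub {E : Type*} [NormedAddCommGroup E]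
    [InnerProductSpace ℝ E] [CompleteSpace E] {f : E → ℝ} (hf : ConvexOn ℝ Set.univ f) {x : E}
    (hfx : DifferentiableAt ℝ f x) (y : E) : inner ℝ (gradient f x) (y - x) ≤ f y - f x := by
  -- Restrict to the line through `x` and `y`: the derivative at 0 is at most the slope from 0 to 1.
  have h₁ : ConvexOn ℝ Set.univ (f ∘ AffineMap.lineMap (k := ℝ) x y) := by
    simpa using hf.comp_affineMap (AffineMap.lineMap (k := ℝ) x y)
  have h₂ : HasDerivAt (f ∘ AffineMap.lineMap (k := ℝ) x y) (fderiv ℝ f x (y - x)) 0 :=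
    HasFDerivAt.comp_hasDerivAt (0 : ℝ) (by simpa using hfx.hasFDerivAt)
      AffineMap.hasDerivAt_lineMap
  have h₃ := h₁.le_slope_of_hasDerivAt (Set.mem_univ 0) (Set.mem_univ 1) one_pos h₂
  simpa [slope_def_field, inner_gradient_left] using h₃

namespace PrimalDual

/-- Truncation changes `a` only when `b = 0`; it then increases `a`, while the factor `b - b' = -b'`
is nonpositive. For `a'` the signs are reversed. -/
theorem sub_mul_plusOperator_sub_le {a a' b b' : ℝ} (hb : 0 ≤ b) (hb' : 0 ≤ b') :
    (b - b') * (plusOperator a b - plusOperator a' b') ≤ (b - b') * (a - a') := by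
  have h₁ : (b - b') * (plusOperator a b - a) ≤ 0 := by
    unfold plusOperator
    split_ifs with h
    · simp
    · have := le_max_right 0 a
      nlinarith
  have h₂ : 0 ≤ (b - b') * (plusOperator a' b' - a') := by
    unfold plusOperator
    split_ifs with h
    · simp
    · have := le_max_right 0 a'
      nlinarith
  linarith

variable {n m : ℕ} {f : EuclideanSpace ℝ (Fin n) → ℝ} {g : Fin m → EuclideanSpace ℝ (Fin n) → ℝ}

/-- The primal-dual vector field is dissipative. -/
theorem inner_sub_vectorField_sub_nonpos (hf : Differentiable ℝ f)
    (hg : ∀ i, Differentiable ℝ (g i)) (hf_concave : ConcaveOn ℝ Set.univ f)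
    (hg_convex : ∀ i, ConvexOn ℝ Set.univ (g i))
    {z w : EuclideanSpace ℝ (Fin n) × EuclideanSpace ℝ (Fin m)}
    (hz : z ∈ domain n m) (hw : w ∈ domain n m) :
    inner ℝ (z.1 - w.1) ((vectorField f g z).1 - (vectorField f g w).1) +
      inner ℝ (z.2 - w.2) ((vectorField f g z).2 - (vectorField f g w).2) ≤ 0 := by
  have hgrad : ∀ x y, inner ℝ (gradient f x) (y - x) ≥ f y - f x := fun x y => by
    have h := hf_concave.neg.inner_gradient_le_sub (hf x).neg y
    rw [inner_gradient_left] at h ⊢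
    rw [fderiv_neg] at h
    simp only [neg_apply, Pi.neg_apply] at h
    linarith
  have hF : inner ℝ (z.1 - w.1) (gradient f z.1 - gradient f w.1) ≤ 0 := by
    have h₁ := hgrad z.1 w.1
    have h₂ := hgrad w.1 z.1
    rw [← neg_sub z.1 w.1, inner_neg_right] at h₁
    rw [inner_sub_right, real_inner_comm, real_inner_comm (gradient f w.1)]
    linarith
  -- The first-order conditions at the two points, weighted by `z.2 i` and `w.2 i`, bound the
  -- gradient term by `-(z.2 i - w.2 i) * (g i z.1 - g i w.1)`, which cancels the bound `h₃` on the
  -- multiplier term.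
  have hG : ∀ i, -inner ℝ (z.1 - w.1) (z.2 i • gradient (g i) z.1 - w.2 i • gradient (g i) w.1) +
      (z.2 i - w.2 i) * (plusOperator (g i z.1) (z.2 i) - plusOperator (g i w.1) (w.2 i)) ≤ 0 := by
    intro i
    have h₁ := (hg_convex i).inner_gradient_le_sub (hg i z.1) w.1
    have h₂ := (hg_convex i).inner_gradient_le_sub (hg i w.1) z.1
    have h₃ := sub_mul_plusOperator_sub_le (a := g i z.1) (a' := g i w.1) (hz i) (hw i)
    rw [← neg_sub z.1 w.1, inner_neg_right] at h₁
    rw [inner_sub_right, inner_smul_right, inner_smul_right, real_inner_comm,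
      real_inner_comm (gradient (g i) w.1)]
    have h₄ := mul_le_mul_of_nonneg_left h₁ (hz i)
    have h₅ := mul_le_mul_of_nonneg_left h₂ (hw i)
    linarith
  have hsum := Finset.sum_nonpos fun i (_ : i ∈ Finset.univ) => hG i
  rw [Finset.sum_add_distrib, Finset.sum_neg_distrib, ← inner_sum, Finset.sum_sub_distrib] at hsum
  have h₁ : (vectorField f g z).1 - (vectorField f g w).1 = (gradient f z.1 - gradient f w.1) -
      (∑ i, z.2 i • gradient (g i) z.1 - ∑ i, w.2 i • gradient (g i) w.1) := by
    simp only [vectorField]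
    abel
  have h₂ : inner ℝ (z.2 - w.2) ((vectorField f g z).2 - (vectorField f g w).2) =
      ∑ i, (z.2 i - w.2 i) *
        (plusOperator (g i z.1) (z.2 i) - plusOperator (g i w.1) (w.2 i)) := by
    simp [PiLp.inner_apply, vectorField, mul_comm]
  rw [h₁, h₂, inner_sub_right]
  linarith

/-- A time shift of a solution on `[0, ∞)` is a solution. -/
theorem IsCaratheodorySolution.comp_const_add {E : Type*} [NormedAddCommGroup E] [NormedSpace ℝ E]
    {F : E → E} {D : Set E} {γ : ℝ → E} (hγ : IsCaratheodorySolution F D ⊤ γ) {s : ℝ}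
    (hs : 0 ≤ s) : IsCaratheodorySolution F D ⊤ (fun t => γ (s + t)) where
  pos := hγ.pos
  mem t ht _ := hγ.mem (s + t) (by positivity) (EReal.coe_lt_top _)
  absolutelyContinuous b hb _ :=
    ((hγ.absolutelyContinuous (s + b) (by positivity) (EReal.coe_lt_top _)).mono
      (Set.uIcc_subset_uIcc_right (by
        rw [Set.mem_uIcc]; left; constructor <;> linarith))).comp_const_add
  hasDerivAt := by
    -- Translations preserve null sets.
    have h := (measurePreserving_add_left volume s).quasiMeasurePreserving.ae hγ.hasDerivAt
    filter_upwards [h] with t ht ht₀ _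
    exact (ht (by positivity) (EReal.coe_lt_top _)).comp_const_add s t

/-- The Euclidean distance between two solutions does not increase. -/
theorem norm_sq_sub_le (hf : Differentiable ℝ f)
    (hg : ∀ i, Differentiable ℝ (g i)) (hf_concave : ConcaveOn ℝ Set.univ f)
    (hg_convex : ∀ i, ConvexOn ℝ Set.univ (g i)) {T : EReal}
    {γ φ : ℝ → EuclideanSpace ℝ (Fin n) × EuclideanSpace ℝ (Fin m)}
    (hγ : IsCaratheodorySolution (vectorField f g) (domain n m) ⊤ γ)
    (hφ : IsCaratheodorySolution (vectorField f g) (domain n m) T φ)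
    {t : ℝ} (ht : 0 ≤ t) (htT : (t : EReal) < T) :
    ‖(γ t - φ t).1‖ ^ 2 + ‖(γ t - φ t).2‖ ^ 2 ≤ ‖(γ 0 - φ 0).1‖ ^ 2 + ‖(γ 0 - φ 0).2‖ ^ 2 := by
  have hac := (hγ.absolutelyContinuous t ht (EReal.coe_lt_top _)).sub
    (hφ.absolutelyContinuous t ht htT)
  have h₁ := (lipschitzWith_one_norm.comp LipschitzWith.prod_fst).comp_absolutelyContinuousOnInterval
    hac
  have h₂ := (lipschitzWith_one_norm.comp LipschitzWith.prod_snd).comp_absolutelyContinuousOnInterval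
    hac
  have hV : AbsolutelyContinuousOnInterval
      (fun s => ‖(γ s - φ s).1‖ ^ 2 + ‖(γ s - φ s).2‖ ^ 2) 0 t := by
    simp only [pow_two]
    exact (h₁.fun_mul h₁).fun_add (h₂.fun_mul h₂)
  refine hV.le_of_deriv_nonpos ht ?_
  filter_upwards [hγ.hasDerivAt, hφ.hasDerivAt] with s hγs hφs hs
  have hsT : (s : EReal) < T := lt_trans (EReal.coe_lt_coe_iff.2 hs.2) htT
  have hd := (hγs hs.1.le (EReal.coe_lt_top _)).sub (hφs hs.1.le hsT)
  have hd₁ := (hasFDerivAt_fst.comp_hasDerivAt s hd).norm_sq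
  have hd₂ := (hasFDerivAt_snd.comp_hasDerivAt s hd).norm_sq
  have hmain := inner_sub_vectorField_sub_nonpos hf hg hf_concave hg_convex
    (hγ.mem s hs.1.le (EReal.coe_lt_top _)) (hφ.mem s hs.1.le hsT)
  have hderiv := (hd₁.add hd₂).deriv
  refine hderiv.trans_le ?_
  rw [← mul_add]
  exact mul_nonpos_of_nonneg_of_nonpos zero_le_two hmain

end PrimalDual

theorem mainTheorem3 (n m : ℕ)
    (f : EuclideanSpace ℝ (Fin n) → ℝ) (g : Fin m → EuclideanSpace ℝ (Fin n) → ℝ)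
    (hf : ContDiff ℝ 1 f) (hg : ∀ i, ContDiff ℝ 1 (g i))
    (hf_concave : StrictConcaveOn ℝ Set.univ f)
    (hg_convex : ∀ i, ConvexOn ℝ Set.univ (g i))
    (hf_lip : LocallyLipschitz (gradient f))
    (hg_lip : ∀ i, LocallyLipschitz (gradient (g i)))
    (hslater : ∃ x, ∀ i, g i x < 0)
    (γ : ℝ → EuclideanSpace ℝ (Fin n) × EuclideanSpace ℝ (Fin m))
    (hγ : PrimalDual.IsCaratheodorySolution (PrimalDual.vectorField f g)
      (PrimalDual.domain n m) ⊤ γ)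
    (hγ0 : γ 0 ∈ PrimalDual.domain n m) :
    PrimalDual.IsInvariant (PrimalDual.vectorField f g) (PrimalDual.domain n m)
      (PrimalDual.omegaLimitSet γ) := by
  rintro T φ hφ ⟨t, ht₀, ht, hlim⟩ s hs hsT
  refine ⟨fun k => t k + s, fun k => add_nonneg (ht₀ k) hs, tendsto_atTop_add_const_right _ s ht, ?_⟩
  have hle := fun k => PrimalDual.norm_sq_sub_le (hf.differentiable one_ne_zero)
    (fun i => (hg i).differentiable one_ne_zero) hf_concave.concaveOn hg_convex
    (hγ.comp_const_add (ht₀ k)) hφ hs hsT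
  simp only [add_zero] at hle
  have h₀ : Tendsto (fun k => γ (t k) - φ 0) atTop (𝓝 0) := by
    simpa using hlim.sub_const (φ 0)
  have h₁ : Tendsto (fun k => ‖(γ (t k) - φ 0).1‖ ^ 2 + ‖(γ (t k) - φ 0).2‖ ^ 2) atTop (𝓝 0) := by
    simpa using (h₀.fst_nhds.norm.pow 2).add (h₀.snd_nhds.norm.pow 2)
  have h₂ : Tendsto (fun k => ‖γ (t k + s) - φ s‖ ^ 2) atTop (𝓝 0) := by
    refine squeeze_zero (fun k => by positivity) (fun k => le_trans ?_ (hle k)) h₁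
    -- The norm on the product is the maximum of the two norms, so its square is at most the sum of
    -- their squares.
    rcases max_choice ‖(γ (t k + s) - φ s).1‖ ‖(γ (t k + s) - φ s).2‖ with h | h <;>
      rw [Prod.norm_def, h] <;> nlinarith [sq_nonneg ‖(γ (t k + s) - φ s).1‖,
        sq_nonneg ‖(γ (t k + s) - φ s).2‖]
  rw [tendsto_iff_norm_sub_tendsto_zero]
  simpa [Real.sqrt_sq] using h₂.sqrt
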